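/- For a non-empty set $X$ let $PT(X)$ be the set of all partial functions from $X$ to $X$, equipped with three binary operations: composition $f\cdot g=fg$ (first $f$, then $g$), domain restriction $f\circ g$ (the restriction of $g$ to $\mathrm{dom}(f)\cap\mathrm{dom}(g)$), and difference $f\backslash g=\{(x,y)\mid (x,y)\in f,\ (x,y)\notin g\}$. An algebra of partial functions of signature $(\cdot,\circ,\backslash)$ is a subset of some $PT(X)$ closed under these three operations. **Proposition.** The class of algebras isomorphic to algebras of partial functions of signature $(\cdot,\circ,\backslash)$ is a finitely axiomatised variety. Namely, an algebra $(A,\cdot,\circ,\backslash)$ with three binary operations is isomorphic to an algebra of partial functions if and only if it satisfies the following finitely many equations, in which $\cdot$ is written as juxtaposition and $s\cap t$ abbreviates $s\backslash(s\backslash t)$: 1. (laws for $\circ,\backslash$) $x\backslash(y\backslash x)=x$; $\ x\cap y=y\cap x$; $\ (x\backslash y)\backslash z=(x\backslash z)\backslash y$; $\ (x\circ z)\cap(y\circ z)=(x\circ y)\circ z$; $\ (x\cap y)\circ x=x\cap y$; 2. (laws of 1-stacks with intersection) - $(x\circ y)\circ z=x\circ(y\circ z)$; $\ x\circ x=x$;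 $\ (x\circ y)\circ z=(y\circ x)\circ z$; - $(xy)z=x(yz)$; $\ x\circ(yz)=(x\circ y)z$; $\ x(y\circ z)=xy\circ xz$; - $(x\cap y)\cap z=x\cap(y\cap z)$; $\ x\cap y=y\cap x$; $\ x\cap x=x$; $\ (x\cap y)\circ x=x\cap y$; $\ x\circ(y\cap z)=(x\circ y)\cap z$; - $x(y\cap z)=xy\cap xz$; 3. $x(y\backslash z)=xy\backslash xz$. -/

import Mathlib

open FirstOrder

universe u

namespace PartialFunctionAlgebra

/-- The three operation symbols, all binary: composition, domain restriction and difference. -/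
inductive Op : ℕ → Type
  | comp : Op 2
  | dres : Op 2
  | diff : Op 2

/-- The purely algebraic signature with composition, domain restriction and difference. -/
def Sig : Language := ⟨Op, fun _ => Empty⟩

section Operations

variable {X : Type*}

/-- Composition written in diagrammatic order: first `f`, then `g`. -/
def composition (f g : X →. X) : X →. X := g.comp f

/-- Domain restriction: `g` restricted to the domain of `f`. -/
def domainRestriction (f g : X →. X) : X →. X := fun x =>
  (g x).restrict ((f x).Dom ∧ (g x).Dom) And.right

/-- Set-theoretic difference of the graphs of `f` and `g`. -/
def difference (f g : X →. X) : X →. X := fun x =>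
  (f x).restrict (∃ y ∈ f x, y ∉ g x) (fun h => Part.dom_iff_mem.2 ⟨h.choose, h.choose_spec.1⟩)

theorem mem_composition {f g : X →. X} {x y : X} :
    y ∈ composition f g x ↔ ∃ z ∈ f x, y ∈ g z := by
  simp only [composition, PFun.comp_apply]
  exact Part.mem_bind_iff

theorem mem_domainRestriction {f g : X →. X} {x y : X} :
    y ∈ domainRestriction f g x ↔ (f x).Dom ∧ y ∈ g x := by
  simp only [domainRestriction, Part.mem_restrict]
  exact ⟨fun h => ⟨h.1.1, h.2⟩, fun h => ⟨⟨h.1, Part.dom_iff_mem.2 ⟨y, h.2⟩⟩, h.2⟩⟩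

theorem mem_difference {f g : X →. X} {x y : X} :
    y ∈ difference f g x ↔ y ∈ f x ∧ y ∉ g x := by
  simp only [difference, Part.mem_restrict]
  constructor
  · rintro ⟨⟨z, hz, hg⟩, hy⟩
    exact ⟨hy, Part.mem_unique hz hy ▸ hg⟩
  · exact fun h => ⟨⟨y, h⟩, h.1⟩

end Operations

/-- All partial functions on `X`, with the three operations. -/
instance partialFunctionStructure (X : Type*) : Sig.Structure (X →. X) where
  funMap := fun {n} o =>
    match n, o with
    | _, Op.comp => fun v => composition (v 0) (v 1)
    | _, Op.dres => fun v => domainRestriction (v 0) (v 1)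
    | _, Op.diff => fun v => difference (v 0) (v 1)
  RelMap := fun r => nomatch r

/-- `A` belongs to the isomorphism class of the algebras of partial functions: it is isomorphic to
a set of partial functions on some non-empty set `X` that is closed under the three operations. -/
def IsFunctional (A : Type u) [Sig.Structure A] : Prop :=
  ∃ (X : Type u) (_ : Nonempty X) (S : Sig.Substructure (X →. X)), Nonempty (A ≃[Sig] S)

/-- Terms of the signature in three variables. -/
abbrev Tm : Type := Sig.Term (Fin 3)

/-- The term `s · t`. -/
instance : Mul Tm := ⟨fun s t => Language.Functions.apply₂ (L := Sig) Op.comp s t⟩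

/-- The term `s ∖ t`. -/
instance : SDiff Tm := ⟨fun s t => Language.Functions.apply₂ (L := Sig) Op.diff s t⟩

/-- The term `s ∩ t`, which abbreviates `s ∖ (s ∖ t)`. -/
instance : Inter Tm := ⟨fun s t => s \ (s \ t)⟩

/-- The term `s ▷ t`, domain restriction of `t` to the domain of `s`. -/
def Tm.dres (s t : Tm) : Tm := Language.Functions.apply₂ (L := Sig) Op.dres s t

infixl:70 " ▷ " => Tm.dres

/-- The three variables. -/
def x : Tm := Language.Term.var 0
def y : Tm := Language.Term.var 1
def z : Tm := Language.Term.var 2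

/-- An equation, that is, a pair of terms. -/
abbrev Equation : Type := Tm × Tm

/-- `A` satisfies the equation identically: it holds under every assignment of the variables. -/
def Satisfies (A : Type*) [Sig.Structure A] (e : Equation) : Prop :=
  ∀ v : Fin 3 → A, e.1.realize v = e.2.realize v

/-- The class of algebras defined by a set of equations. -/
def IsModel (A : Type*) [Sig.Structure A] (E : List Equation) : Prop :=
  ∀ e ∈ E, Satisfies A e

/-- The laws for domain restriction and difference. -/
def differenceRestrictionLaws : List Equation :=
  [ (x \ (y \ x), x),
    (x ∩ y, y ∩ x),
    ((x \ y) \ z, (x \ z) \ y),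
    ((x ▷ z) ∩ (y ▷ z), (x ▷ y) ▷ z),
    ((x ∩ y) ▷ x, x ∩ y) ]

/-- The laws of right normal bands. -/
def rightNormalBandLaws : List Equation :=
  [ ((x ▷ y) ▷ z, x ▷ (y ▷ z)),
    (x ▷ x, x),
    ((x ▷ y) ▷ z, (y ▷ x) ▷ z) ]

/-- The laws of 1-stacks. -/
def oneStackLaws : List Equation :=
  rightNormalBandLaws ++
  [ ((x * y) * z, x * (y * z)),
    (x ▷ (y * z), (x ▷ y) * z),
    (x * (y ▷ z), (x * y) ▷ (x * z)) ]

/-- The laws of right normal bands with intersection. -/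
def rightNormalBandWithIntersectionLaws : List Equation :=
  rightNormalBandLaws ++
  [ ((x ∩ y) ∩ z, x ∩ (y ∩ z)),
    (x ∩ y, y ∩ x),
    (x ∩ x, x),
    ((x ∩ y) ▷ x, x ∩ y),
    (x ▷ (y ∩ z), (x ▷ y) ∩ z) ]

/-- The laws of 1-stacks with intersection. -/
def oneStackWithIntersectionLaws : List Equation :=
  oneStackLaws ++ rightNormalBandWithIntersectionLaws ++
  [ (x * (y ∩ z), (x * y) ∩ (x * z)) ]

/-- The complete finite list of equations. -/
def laws : List Equation :=
  differenceRestrictionLaws ++ oneStackWithIntersectionLaws ++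
  [ (x * (y \ z), (x * y) \ (x * z)) ]

end PartialFunctionAlgebra

/-! Soundness is a pointwise check on graphs, and equations pass to subalgebras. For completeness,
points are recovered from the algebra. The functions defined at a point form a set `D` that is
closed under restriction in both directions, omits zero, and contains `a \ b` or `a ⋒ b` whenever it
contains `a`. By Zorn every nonzero element lies in such a prime filter
(`exists_isPrimeDomainFilter`). Fix `D` and call `s`, `t` equivalent when `s ⋒ t ∈ D`; the classes
(germs) are the values at that point. An element `a` acts by right multiplication, sending the germ
of `s` to that of `s * a` when `s * a ∈ D`. This is well defined by `meet_mul` and turns the three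
operations into those on partial functions. Adjoining an identity `none` as a base germ makes the
action faithful: a nonzero `a \ b` is defined at the base germ of some `D`. -/

namespace PartialFunctionAlgebra

/-- Algebras of the signature satisfying a set of equations sufficient for a representation by
partial functions. -/
class RestrictionAlgebra (A : Type u) extends Mul A, SDiff A where
  /-- Domain restriction: `res a b` is `b` restricted to the domain of `a`. -/
  res : A → A → A
  sdiff_sdiff_self (a b : A) : a \ (b \ a) = a
  meet_comm (a b : A) : a \ (a \ b) = b \ (b \ a)
  sdiff_right_comm (a b c : A) : (a \ b) \ c = (a \ c) \ b
  meet_idem (a : A) : a \ (a \ a) = a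
  meet_assoc (a b c : A) :
    (a \ (a \ b)) \ ((a \ (a \ b)) \ c) = a \ (a \ (b \ (b \ c)))
  meet_res (a b : A) : res (a \ (a \ b)) a = a \ (a \ b)
  res_meet (a b c : A) : res a (b \ (b \ c)) = res a b \ (res a b \ c)
  res_assoc (a b c : A) : res (res a b) c = res a (res b c)
  res_self (a : A) : res a a = a
  res_swap (a b c : A) : res (res a b) c = res (res b a) c
  mul_assoc (a b c : A) : (a * b) * c = a * (b * c)
  res_mul (a b c : A) : res a (b * c) = res a b * c
  mul_res (a b c : A) : a * res b c = res (a * b) (a * c)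
  mul_sdiff (a b c : A) : a * (b \ c) = (a * b) \ (a * c)

namespace RestrictionAlgebra

/-! ### Arithmetic of difference, meet and zero. -/

variable {A : Type u} [RestrictionAlgebra A]

/-- The intersection, defined from the difference. -/
def meet (a b : A) : A := a \ (a \ b)

local infixl:70 " ⋒ " => meet
local infixl:70 " ⊳ " => res

theorem meet_comm' (a b : A) : a ⋒ b = b ⋒ a := meet_comm a b

theorem meet_self (a : A) : a ⋒ a = a := meet_idem a

theorem meet_assoc' (a b c : A) : a ⋒ b ⋒ c = a ⋒ (b ⋒ c) := meet_assoc a b c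

theorem meet_res_left (a b : A) : (a ⋒ b) ⊳ a = a ⋒ b := meet_res a b

theorem meet_res_right (a b : A) : (a ⋒ b) ⊳ b = a ⋒ b := by
  rw [meet_comm', meet_res_left]

theorem res_meet' (a b c : A) : a ⊳ (b ⋒ c) = (a ⊳ b) ⋒ c := res_meet a b c

theorem res_left_comm (a b c : A) : a ⊳ (b ⊳ c) = b ⊳ (a ⊳ c) := by
  rw [← res_assoc, res_swap, res_assoc]

theorem res_res_self (a b : A) : a ⊳ (a ⊳ b) = a ⊳ b := by rw [← res_assoc, res_self]

theorem sdiff_sdiff_right_self (a b : A) : (b \ a) \ a = b \ a := by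
  have h := sdiff_sdiff_self (b \ a) a
  rwa [sdiff_sdiff_self a b] at h

theorem sdiff_self_eq_sdiff_self_sdiff (a b : A) : a \ a = (b \ a) \ (b \ a) := by
  have key (c e : A) : (c \ e) \ (c \ e) = (e \ e) \ (e \ c) := by
    rw [sdiff_right_comm, meet_comm, sdiff_right_comm]
  have h := key a (b \ a)
  rwa [sdiff_sdiff_self, sdiff_sdiff_right_self, sdiff_sdiff_right_self] at h

/-- By the previous lemma used twice, `c ⋒ e` has the same self-difference as `e`; commutativity of
the meet then links any two elements. This is what provides a zero. -/
theorem sdiff_self_eq (a b : A) : a \ a = b \ b := by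
  have h (c e : A) : (c ⋒ e) \ (c ⋒ e) = e \ e := by
    rw [meet, ← sdiff_self_eq_sdiff_self_sdiff, ← sdiff_self_eq_sdiff_self_sdiff]
  rw [← h b a, meet_comm', h]

/-- The empty function. -/
def IsZero (a : A) : Prop := ∀ b : A, a = b \ b

theorem isZero_sdiff_self (a : A) : IsZero (a \ a) := sdiff_self_eq a

theorem IsZero.sdiff {a : A} (ha : IsZero a) (b : A) : a \ b = a := by
  rw [ha b, sdiff_sdiff_right_self]

theorem IsZero.sdiff_right {a : A} (ha : IsZero a) (b : A) : b \ a = b := by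
  rw [ha b, meet_idem]

theorem IsZero.meet {a : A} (ha : IsZero a) (b : A) : a ⋒ b = a := by
  rw [RestrictionAlgebra.meet, ha.sdiff]

theorem IsZero.res_right {a : A} (ha : IsZero a) (b : A) : b ⊳ a = a := by
  rw [← ha.meet a, res_meet', meet_comm', ha.meet, ha.meet]

theorem IsZero.res_left {a : A} (ha : IsZero a) (b : A) : a ⊳ b = a := by
  have h := meet_res_right a b
  rwa [ha.meet] at h

theorem sdiff_meet_self (a b : A) : (a \ b) ⋒ a = a \ b := by
  rw [meet, sdiff_right_comm a b a, (isZero_sdiff_self a).sdiff,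
    (isZero_sdiff_self a).sdiff_right]

theorem isZero_sdiff_meet (a b : A) : IsZero ((a \ b) ⋒ b) := by
  rw [meet, sdiff_sdiff_right_self]
  exact isZero_sdiff_self _

theorem res_meet_self (a b : A) : (a ⊳ b) ⋒ b = a ⊳ b := by rw [← res_meet', meet_self]

theorem sdiff_meet_sdiff {k a : A} (h : k ⋒ a = k) (b : A) : (k \ b) ⋒ (a \ b) = k \ b := by
  have h' : k \ b = (a \ b) \ (a \ k) := by
    rw [sdiff_right_comm, ← meet, ← meet_comm', h]
  rw [h', sdiff_meet_self]

theorem isZero_of_sdiff_of_meet {a b : A} (h₁ : IsZero (a \ b)) (h₂ : IsZero (a ⋒ b)) :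
    IsZero a := by
  rwa [meet, h₁.sdiff_right] at h₂

/-- Stands in for the decomposition of `a` into `a \ b` and `a ⋒ b`, there being no union: `(c ⊳ a)
\ b` lies below `c ⊳ (a \ b)`. Primality of maximal filters rests on it. -/
theorem isZero_res {a b c : A} (h₁ : IsZero (c ⊳ (a \ b))) (h₂ : IsZero (c ⊳ (a ⋒ b))) :
    IsZero (c ⊳ a) := by
  refine isZero_of_sdiff_of_meet (b := b) ?_ (by rwa [← res_meet'])
  set k := c ⊳ a with hk
  have hck : c ⊳ (k \ b) = k \ b := by
    have h : k \ b = c ⊳ (a ⋒ (k \ b)) := by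
      rw [res_meet', ← hk, meet_comm', sdiff_meet_self]
    rw [h, res_res_self]
  have h : k \ b = (c ⊳ (a \ b)) ⋒ (k \ b) := by
    rw [← res_meet', meet_comm', sdiff_meet_sdiff (res_meet_self c a), hck]
  rw [h, h₁.meet]
  exact h₁

theorem eq_of_isZero_sdiff {a b : A} (h₁ : IsZero (a \ b)) (h₂ : IsZero (b \ a)) : a = b := by
  rw [← h₁.sdiff_right a, meet_comm, h₂.sdiff_right]

/-! ### Domain filters and their maximal extensions. -/

/-- Sets of elements that behave like the set of the functions defined at a given point, as far as
domain restriction is concerned. -/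
structure IsDomainFilter (D : Set A) : Prop where
  res_mem_iff (a b : A) : a ⊳ b ∈ D ↔ a ∈ D ∧ b ∈ D
  not_isZero {a : A} : a ∈ D → ¬ IsZero a

namespace IsDomainFilter

theorem mem_of_meet {D : Set A} (hD : IsDomainFilter D) {a b : A} (h : a ⋒ b ∈ D) : b ∈ D := by
  rw [← meet_res_right] at h
  exact ((hD.res_mem_iff _ _).1 h).2

theorem mem_of_le {D : Set A} (hD : IsDomainFilter D) {a b : A} (ha : a ∈ D) (h : a ⋒ b = a) :
    b ∈ D := hD.mem_of_meet (a := a) (by rwa [h])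

theorem meet_trans {D : Set A} (hD : IsDomainFilter D) {a b c : A} (h₁ : a ⋒ b ∈ D)
    (h₂ : b ⋒ c ∈ D) : a ⋒ c ∈ D := by
  have h := (hD.res_mem_iff _ _).2 ⟨h₁, h₂⟩
  rw [res_meet', meet_res_right, meet_comm' a b, meet_assoc'] at h
  exact hD.mem_of_meet h

theorem mem_of_mul_mem {D : Set A} (hD : IsDomainFilter D) {a b : A} (h : a * b ∈ D) : a ∈ D := by
  rw [← res_self a, ← res_mul] at h
  exact ((hD.res_mem_iff _ _).1 h).1

/-- On the domain of `a ⋒ b`, both products restrict to `(a ⋒ b) * c`, which is in `D` and below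
both. -/
theorem meet_mul {D : Set A} (hD : IsDomainFilter D) {a b c : A} (h₁ : a ⋒ b ∈ D)
    (h₂ : a * c ∈ D) : (a * c) ⋒ (b * c) ∈ D := by
  have h₃ := (hD.res_mem_iff _ _).2 ⟨h₁, h₂⟩
  rw [res_mul, meet_res_left] at h₃
  have hb : (a ⋒ b) * c = (a ⋒ b) ⊳ (b * c) := by rw [res_mul, meet_res_right]
  have ha : (a ⋒ b) * c = (a ⋒ b) ⊳ (a * c) := by rw [res_mul, meet_res_left]
  refine hD.mem_of_le h₃ ?_
  rw [← meet_assoc', ha, res_meet_self, ← ha, hb, res_meet_self]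

theorem not_sdiff_mem_and_meet_mem {D : Set A} (hD : IsDomainFilter D) {a b : A}
    (h₁ : a \ b ∈ D) : a ⋒ b ∉ D := by
  intro h₂
  have h := (hD.res_mem_iff _ _).2 ⟨h₁, h₂⟩
  rw [res_meet', ← sdiff_meet_self a b, meet_res_right, sdiff_meet_self] at h
  exact hD.not_isZero h (isZero_sdiff_meet a b)

/-- This is the filter generated by `D` and `g`: the elements whose domain contains that of some `c
⊳ g` with `c ∈ D`. The hypothesis `hg` keeps zero out. -/
theorem adjoin {D : Set A} (hD : IsDomainFilter D) {g : A} (hg : ∀ c ∈ D, ¬ IsZero (c ⊳ g)) :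
    IsDomainFilter {e : A | ∃ c ∈ D, e ⊳ (c ⊳ g) = c ⊳ g} where
  res_mem_iff a b := by
    constructor
    · rintro ⟨c, hc, h⟩
      rw [res_assoc] at h
      refine ⟨⟨c, hc, ?_⟩, c, hc, ?_⟩ <;> rw [← h]
      · rw [res_res_self]
      · rw [res_left_comm, res_res_self]
    · rintro ⟨⟨c, hc, h⟩, c', hc', h'⟩
      refine ⟨c ⊳ c', (hD.res_mem_iff _ _).2 ⟨hc, hc'⟩, ?_⟩
      rw [res_assoc, res_assoc, res_left_comm b, h', res_left_comm c, res_left_comm a, h]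
  not_isZero := by
    rintro e ⟨c, hc, h⟩ he
    rw [he.res_left] at h
    exact hg c hc (h ▸ he)

end IsDomainFilter

/-- The domain filters that are the set of all functions defined at some point. -/
structure IsPrimeDomainFilter (D : Set A) : Prop extends IsDomainFilter D where
  sdiff_or_meet {a : A} (b : A) : a ∈ D → a \ b ∈ D ∨ a ⋒ b ∈ D

theorem IsPrimeDomainFilter.sdiff_mem_iff {D : Set A} (hD : IsPrimeDomainFilter D) {a b : A} :
    a \ b ∈ D ↔ a ∈ D ∧ a ⋒ b ∉ D := by
  constructor
  · exact fun h => ⟨hD.mem_of_le h (sdiff_meet_self a b), hD.not_sdiff_mem_and_meet_mem h⟩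
  · exact fun h => (hD.sdiff_or_meet b h.1).resolve_right h.2

theorem exists_isPrimeDomainFilter {d : A} (hd : ¬ IsZero d) :
    ∃ D : Set A, IsPrimeDomainFilter D ∧ d ∈ D := by
  have hbase : IsDomainFilter {e : A | e ⊳ d = d} := by
    refine ⟨fun a b => ⟨fun h => ?_, fun h => ?_⟩, fun {a} h ha => ?_⟩
    · simp only [Set.mem_ofPred_eq, res_assoc] at h
      constructor <;> simp only [Set.mem_ofPred_eq] <;> rw [← h]
      · rw [res_res_self]
      · rw [res_left_comm, res_res_self]
    · have h₁ : a ⊳ d = d := h.1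
      have h₂ : b ⊳ d = d := h.2
      simp only [Set.mem_ofPred_eq, res_assoc, h₂, h₁]
    · rw [Set.mem_ofPred_eq, ha.res_left] at h
      exact hd (h ▸ ha)
  obtain ⟨D, hsub, hmax⟩ := zorn_subset_nonempty {D : Set A | IsDomainFilter D} (by
    rintro C hC hchain ⟨D₀, hD₀⟩
    refine ⟨⋃₀ C, ⟨fun a b => ⟨?_, ?_⟩, ?_⟩, fun s hs => Set.subset_sUnion_of_mem hs⟩
    · rintro ⟨D, hD, h⟩
      have h' := ((hC hD).res_mem_iff a b).1 h
      exact ⟨⟨D, hD, h'.1⟩, D, hD, h'.2⟩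
    · rintro ⟨⟨D, hD, h⟩, D', hD', h'⟩
      rcases hchain.total hD hD' with hle | hle
      · exact ⟨D', hD', ((hC hD').res_mem_iff a b).2 ⟨hle h, h'⟩⟩
      · exact ⟨D, hD, ((hC hD).res_mem_iff a b).2 ⟨h, hle h'⟩⟩
    · rintro a ⟨D, hD, h⟩
      exact (hC hD).not_isZero h) _ hbase
  have hD : IsDomainFilter D := hmax.prop
  have hdD : d ∈ D := hsub (res_self d)
  -- Otherwise `g` could be adjoined, against maximality.
  have hex {g : A} (hg : g ∉ D) : ∃ c ∈ D, IsZero (c ⊳ g) := by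
    by_contra! hne
    refine hg (hmax.le_of_ge (hD.adjoin hne) ?_ ⟨d, hdD, ?_⟩)
    · exact fun e he => ⟨e, he, res_res_self e g⟩
    · rw [res_left_comm, res_self]
  refine ⟨D, ⟨hD, fun {a} b ha => ?_⟩, hdD⟩
  by_contra! h
  obtain ⟨c, hc, hc0⟩ := hex h.1
  obtain ⟨c', hc', hc0'⟩ := hex h.2
  -- If both pieces of `a` were missing, `a` would vanish on a domain belonging to `D`.
  have hcc : IsZero ((c ⊳ c') ⊳ a) := by
    refine isZero_res (b := b) ?_ ?_
    · rw [res_assoc, res_left_comm, hc0.res_right]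
      exact hc0
    · rw [res_assoc, hc0'.res_right]
      exact hc0'
  refine hD.not_isZero ?_ hcc
  simp only [hD.res_mem_iff]
  exact ⟨⟨hc, hc'⟩, ha⟩

/-! ### The representation on germs. -/

/-- The right action of the algebra on itself with an identity adjoined. -/
def act : Option A → A → A
  | none, a => a
  | some s, a => s * a

theorem act_mul (s : Option A) (a b : A) : act s (a * b) = act s a * b := by
  cases s
  · rfl
  · exact (mul_assoc _ _ _).symm

theorem act_res (s : Option A) (a b : A) : act s (a ⊳ b) = act s a ⊳ act s b := by
  cases s
  · rfl
  · exact mul_res _ _ _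

theorem act_sdiff (s : Option A) (a b : A) : act s (a \ b) = act s a \ act s b := by
  cases s
  · rfl
  · exact mul_sdiff _ _ _

/-- The germ of an element at the point given by `D`. -/
def germ (D : Set A) : Option A → Option (Set A)
  | none => none
  | some s => some {t | s ⋒ t ∈ D}

/-- Membership `s ∈ D` matters: all elements outside `D` share the empty germ. -/
theorem germ_some_eq_iff {D : Set A} (hD : IsDomainFilter D) {s t : A} (hs : s ∈ D) :
    germ D (some s) = germ D (some t) ↔ s ⋒ t ∈ D := by
  simp only [germ, Option.some.injEq]
  constructor
  · intro h
    have h' : s ∈ {r | s ⋒ r ∈ D} := by rwa [Set.mem_ofPred_eq, meet_self]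
    rw [h, Set.mem_ofPred_eq] at h'
    rwa [meet_comm']
  · intro h
    ext r
    exact ⟨fun h' => hD.meet_trans (by rwa [meet_comm']) h', fun h' => hD.meet_trans h h'⟩

/-- Independence of the representative of a germ. The base germ `none` is never identified with that
of an element. -/
theorem act_meet_act_mem {D : Set A} (hD : IsDomainFilter D) {s t : Option A}
    (h : germ D s = germ D t) {a : A} (ha : act s a ∈ D) : act s a ⋒ act t a ∈ D := by
  cases s with
  | none =>
    cases t with
    | none => rwa [meet_self]
    | some t => simp [germ] at h
  | some s =>
    cases t with
    | none => simp [germ] at h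
    | some t =>
      exact hD.meet_mul ((germ_some_eq_iff hD (hD.mem_of_mul_mem ha)).1 h) ha

/-- The graph of the partial function representing `a`. -/
def Graph (a : A) (p q : Set A × Option (Set A)) : Prop :=
  IsPrimeDomainFilter p.1 ∧ ∃ s, p.2 = germ p.1 s ∧ act s a ∈ p.1 ∧
    q = (p.1, germ p.1 (some (act s a)))

theorem graph_germ_iff {a : A} {D : Set A} {s : Option A} {q : Set A × Option (Set A)} :
    Graph a (D, germ D s) q ↔
      IsPrimeDomainFilter D ∧ act s a ∈ D ∧ q = (D, germ D (some (act s a))) := by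
  constructor
  · rintro ⟨hD, t, ht, hta, rfl⟩
    have h := act_meet_act_mem hD.toIsDomainFilter ht.symm hta
    exact ⟨hD, hD.mem_of_meet h,
      by rw [(germ_some_eq_iff hD.toIsDomainFilter hta).2 h]⟩
  · rintro ⟨hD, hs, rfl⟩
    exact ⟨hD, s, rfl, hs, rfl⟩

theorem Graph.eq {a : A} {p q r : Set A × Option (Set A)} (hq : Graph a p q) (hr : Graph a p r) :
    q = r := by
  obtain ⟨D, c⟩ := p
  obtain ⟨-, s, hs, -, rfl⟩ := hq
  cases (show c = germ D s from hs)
  exact (graph_germ_iff.1 hr).2.2.symm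

/-- The partial function representing `a`. -/
noncomputable def rep (a : A) : Set A × Option (Set A) →. Set A × Option (Set A) := fun p =>
  ⟨∃ q, Graph a p q, fun h => h.choose⟩

theorem mem_rep {a : A} {p q : Set A × Option (Set A)} : q ∈ rep a p ↔ Graph a p q := by
  constructor
  · rintro ⟨h, rfl⟩
    exact h.choose_spec
  · exact fun h => ⟨⟨q, h⟩, Graph.eq (Exists.choose_spec (⟨q, h⟩ : ∃ q, Graph a p q)) h⟩

theorem mem_rep_germ {a : A} {D : Set A} {s : Option A} {q : Set A × Option (Set A)} :
    q ∈ rep a (D, germ D s) ↔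
      IsPrimeDomainFilter D ∧ act s a ∈ D ∧ q = (D, germ D (some (act s a))) :=
  mem_rep.trans graph_germ_iff

theorem dom_rep_germ {a : A} {D : Set A} {s : Option A} :
    (rep a (D, germ D s)).Dom ↔ IsPrimeDomainFilter D ∧ act s a ∈ D := by
  simp [Part.dom_iff_mem, mem_rep_germ]

/-- Partial functions that are empty outside the domain points coincide once they agree on germs. -/
theorem ext_germ {f g : Set A × Option (Set A) →. Set A × Option (Set A)}
    (hf : ∀ p q, q ∈ f p → ∃ a : A, (rep a p).Dom) (hg : ∀ p q, q ∈ g p → ∃ a : A, (rep a p).Dom)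
    (h : ∀ D : Set A, IsPrimeDomainFilter D → ∀ s q, q ∈ f (D, germ D s) ↔ q ∈ g (D, germ D s)) :
    f = g := by
  have key (p) (hp : ∃ a : A, (rep a p).Dom) (q) : q ∈ f p ↔ q ∈ g p := by
    obtain ⟨a, ⟨r, hD, s, hs, -⟩⟩ := hp
    obtain ⟨D, c⟩ := p
    cases (show c = germ D s from hs)
    exact h D hD s q
  refine PFun.ext fun p q => ⟨fun hq => ?_, fun hq => ?_⟩
  · exact (key p (hf p q hq) q).1 hq
  · exact (key p (hg p q hq) q).2 hq

theorem dom_of_mem_rep (a : A) (p q : Set A × Option (Set A)) (h : q ∈ rep a p) :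
    ∃ a : A, (rep a p).Dom := ⟨a, Part.dom_iff_mem.2 ⟨q, h⟩⟩

theorem rep_mul (a b : A) : rep (a * b) = composition (rep a) (rep b) := by
  refine ext_germ (dom_of_mem_rep _) ?_ fun D hD s q => ?_
  · rintro p q h
    obtain ⟨r, hr, -⟩ := mem_composition.1 h
    exact dom_of_mem_rep a p r hr
  · simp only [mem_composition, mem_rep_germ, act_mul]
    constructor
    · rintro ⟨-, h, rfl⟩
      exact ⟨_, ⟨hD, hD.mem_of_mul_mem h, rfl⟩, mem_rep_germ.2 ⟨hD, h, rfl⟩⟩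
    · rintro ⟨_, ⟨-, h, rfl⟩, h'⟩
      exact mem_rep_germ.1 h'

theorem rep_res (a b : A) : rep (a ⊳ b) = domainRestriction (rep a) (rep b) := by
  refine ext_germ (dom_of_mem_rep _) ?_ fun D hD s q => ?_
  · rintro p q h
    exact ⟨a, (mem_domainRestriction.1 h).1⟩
  · simp only [mem_domainRestriction, mem_rep_germ, dom_rep_germ, act_res, hD, true_and,
      hD.res_mem_iff, and_assoc]
    refine and_congr_right fun ha => and_congr_right fun hb => ?_
    have h := (hD.res_mem_iff _ _).2 ⟨ha, hb⟩
    rw [(germ_some_eq_iff hD.toIsDomainFilter h).2 (by rwa [res_meet_self])]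

theorem rep_sdiff (a b : A) : rep (a \ b) = difference (rep a) (rep b) := by
  refine ext_germ (dom_of_mem_rep _) ?_ fun D hD s q => ?_
  · rintro p q h
    exact dom_of_mem_rep a p q (mem_difference.1 h).1
  · simp only [mem_difference, mem_rep_germ, act_sdiff, hD, true_and, hD.sdiff_mem_iff, and_assoc]
    refine and_congr_right fun ha => ?_
    -- Where the difference is defined it takes the value of `a`; by `h₂`, the values of `a` and `b`
    -- agree exactly when the meet is in `D`.
    have h₁ (h : act s a ⋒ act s b ∉ D) :
        germ D (some (act s a \ act s b)) = germ D (some (act s a)) := by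
      have h' := hD.sdiff_mem_iff.2 ⟨ha, h⟩
      exact (germ_some_eq_iff hD.toIsDomainFilter h').2 (by rwa [sdiff_meet_self])
    have h₂ := germ_some_eq_iff hD.toIsDomainFilter (t := act s b) ha
    constructor
    · rintro ⟨h, rfl⟩
      rw [h₁ h]
      refine ⟨rfl, fun h' => h (h₂.1 (congrArg Prod.snd h'.2))⟩
    · rintro ⟨rfl, h⟩
      have h' : act s a ⋒ act s b ∉ D :=
        fun h' => h ⟨hD.mem_of_meet h', by rw [h₂.2 h']⟩
      exact ⟨h', by rw [h₁ h']⟩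

theorem rep_injective : Function.Injective (rep : A → _) := by
  have key {a b : A} (h : rep a = rep b) : IsZero (a \ b) := by
    by_contra hne
    obtain ⟨D, hD, hd⟩ := exists_isPrimeDomainFilter hne
    -- At the base germ, being defined means being in `D`.
    have h' := dom_rep_germ (s := none).2 ⟨hD, hd⟩
    obtain ⟨q, hq⟩ := Part.dom_iff_mem.1 h'
    rw [rep_sdiff, h, mem_difference] at hq
    exact hq.2 hq.1
  exact fun a b h => eq_of_isZero_sdiff (key h) (key h.symm)

end RestrictionAlgebra

/-! ### From the formal equations to the operations. -/

section Terms

variable {A : Type*} [Sig.Structure A]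

/-- The value of a binary operation symbol. -/
def op (o : Op 2) (a b : A) : A := Language.Structure.funMap (L := Sig) o ![a, b]

theorem realize_mul (s t : Tm) (v : Fin 3 → A) :
    (s * t).realize v = op Op.comp (s.realize v) (t.realize v) :=
  Language.Term.realize_functions_apply₂

theorem realize_dres (s t : Tm) (v : Fin 3 → A) :
    (s ▷ t).realize v = op Op.dres (s.realize v) (t.realize v) :=
  Language.Term.realize_functions_apply₂

theorem realize_sdiff (s t : Tm) (v : Fin 3 → A) :
    (s \ t).realize v = op Op.diff (s.realize v) (t.realize v) :=
  Language.Term.realize_functions_apply₂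

theorem inter_def (s t : Tm) : s ∩ t = s \ (s \ t) := rfl

theorem realize_x (v : Fin 3 → A) : x.realize v = v 0 := rfl
theorem realize_y (v : Fin 3 → A) : y.realize v = v 1 := rfl
theorem realize_z (v : Fin 3 → A) : z.realize v = v 2 := rfl

end Terms

theorem IsModel.exists_restrictionAlgebra {A : Type u} [Sig.Structure A] (h : IsModel A laws) :
    ∃ R : RestrictionAlgebra A, (∀ a b, R.mul a b = op Op.comp a b) ∧
      (∀ a b, R.res a b = op Op.dres a b) ∧ ∀ a b, R.sdiff a b = op Op.diff a b := by
  simp only [IsModel, laws, differenceRestrictionLaws, oneStackWithIntersectionLaws, oneStackLaws,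
    rightNormalBandLaws, rightNormalBandWithIntersectionLaws, List.forall_mem_append,
    List.forall_mem_cons, Satisfies, realize_mul, realize_dres, realize_sdiff, inter_def,
    realize_x, realize_y, realize_z] at h
  obtain ⟨⟨⟨h₁, h₂, h₃, -⟩, ⟨⟨⟨h₄, h₅, h₆, -⟩, h₇, h₈, h₉, -⟩, ⟨-, hh₁, -, hh₂, hh₃, hh₄, -⟩⟩, -⟩,
    hh₅, -⟩ := h
  refine ⟨
    { mul := op Op.comp
      sdiff := op Op.diff
      res := op Op.dres
      sdiff_sdiff_self := fun a b => h₁ ![a, b, a]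
      meet_comm := fun a b => h₂ ![a, b, a]
      sdiff_right_comm := fun a b c => h₃ ![a, b, c]
      meet_idem := fun a => hh₂ ![a, a, a]
      meet_assoc := fun a b c => hh₁ ![a, b, c]
      meet_res := fun a b => hh₃ ![a, b, a]
      res_meet := fun a b c => hh₄ ![a, b, c]
      res_assoc := fun a b c => h₄ ![a, b, c]
      res_self := fun a => h₅ ![a, a, a]
      res_swap := fun a b c => h₆ ![a, b, c]
      mul_assoc := fun a b c => h₇ ![a, b, c]
      res_mul := fun a b c => h₈ ![a, b, c]
      mul_res := fun a b c => h₉ ![a, b, c]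
      mul_sdiff := fun a b c => hh₅ ![a, b, c] }, fun _ _ => rfl, fun _ _ => rfl, fun _ _ => rfl⟩

theorem funMap_eq_op {A : Type*} [Sig.Structure A] (o : Op 2) (v : Fin 2 → A) :
    Language.Structure.funMap (L := Sig) o v = op o (v 0) (v 1) := by
  rw [op]
  congr 1
  ext i
  fin_cases i <;> rfl

theorem IsModel.isFunctional {A : Type u} [Sig.Structure A] (h : IsModel A laws) :
    IsFunctional A := by
  obtain ⟨R, hmul, hres, hsdiff⟩ := h.exists_restrictionAlgebra
  let F : A ↪[Sig] (Set A × Option (Set A) →. Set A × Option (Set A)) :=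
    { toFun := RestrictionAlgebra.rep
      inj' := RestrictionAlgebra.rep_injective
      map_fun' := by
        intro n o v
        change Op n at o
        cases o
        · rw [funMap_eq_op, ← hmul]
          exact RestrictionAlgebra.rep_mul (v 0) (v 1)
        · rw [funMap_eq_op, ← hres]
          exact RestrictionAlgebra.rep_res (v 0) (v 1)
        · rw [funMap_eq_op, ← hsdiff]
          exact RestrictionAlgebra.rep_sdiff (v 0) (v 1)
      map_rel' := fun r => nomatch r }
  exact ⟨_, ⟨(∅, none)⟩, F.toHom.range, ⟨F.equivRange⟩⟩

/-! ### Soundness of the equations. -/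

section Soundness

variable {X : Type*}

theorem op_comp (f g : X →. X) : op Op.comp f g = composition f g := rfl
theorem op_dres (f g : X →. X) : op Op.dres f g = domainRestriction f g := rfl
theorem op_diff (f g : X →. X) : op Op.diff f g = difference f g := rfl

theorem satisfies_of_forall_mem {s t : Tm}
    (h : ∀ (v : Fin 3 → X →. X) (p q : X), q ∈ s.realize v p ↔ q ∈ t.realize v p) :
    Satisfies (X →. X) (s, t) := fun v => PFun.ext (h v)

theorem isModel_pfun : IsModel (X →. X) laws := by
  simp only [IsModel, laws, differenceRestrictionLaws, oneStackWithIntersectionLaws, oneStackLaws,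
    rightNormalBandLaws, rightNormalBandWithIntersectionLaws, List.forall_mem_append,
    List.forall_mem_cons]
  -- Replacing partial functions by single-valued relations turns each law into pure first-order
  -- logic.
  have hrel (f : X →. X) : ∃ F : X → X → Prop,
      (∀ p q, q ∈ f p ↔ F p q) ∧ ∀ p q r, F p q → F p r → q = r :=
    ⟨fun p q => q ∈ f p, fun _ _ => Iff.rfl, fun _ _ _ => Part.mem_unique⟩
  repeat' apply And.intro
  all_goals first
    | exact fun e he => absurd he List.not_mem_nil
    | refine satisfies_of_forall_mem fun v p q => ?_
      obtain ⟨F, hF, hF'⟩ := hrel (v 0)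
      obtain ⟨G, hG, hG'⟩ := hrel (v 1)
      obtain ⟨K, hK, hK'⟩ := hrel (v 2)
      simp only [realize_mul, realize_dres, realize_sdiff, inter_def, realize_x, realize_y,
        realize_z, op_comp, op_dres, op_diff, mem_composition, mem_domainRestriction,
        mem_difference, Part.dom_iff_mem, hF, hG, hK]
      grind

end Soundness

theorem IsFunctional.isModel {A : Type u} [Sig.Structure A] (h : IsFunctional A) :
    IsModel A laws := by
  obtain ⟨X, -, S, ⟨E⟩⟩ := h
  intro e he v
  let F : A ↪[Sig] (X →. X) := S.subtype.comp E.toEmbedding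
  apply F.injective
  rw [← Language.HomClass.realize_term, ← Language.HomClass.realize_term]
  exact isModel_pfun e he _

end PartialFunctionAlgebra

/-- An algebra with three binary operations is isomorphic to an algebra of partial functions under
composition, domain restriction and difference if and only if it satisfies the finitely many
equations in `laws`. -/
theorem proposition5p3 (A : Type u) [PartialFunctionAlgebra.Sig.Structure A] :
    PartialFunctionAlgebra.IsFunctional A ↔
      PartialFunctionAlgebra.IsModel A PartialFunctionAlgebra.laws :=
  ⟨fun h => h.isModel, fun h => h.isFunctional⟩
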